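/- Let $\alpha > 1$ be a real number and let $\epsilon_1, \epsilon_2, \dots$ be i.i.d. random variables on a probability space with $\mathbb{P}(\epsilon_k = 1) = \mathbb{P}(\epsilon_k = -1) = 1/2$. Put $a_n = \lfloor (\log n)^\alpha \rfloor$ for $n \ge 1$, where $\log$ is the natural logarithm, and let \[ X_n = \sum_{k=1}^n \epsilon_k a_k \qquad (n \ge 0) \] be the Rademacher random walk with step sizes $(a_n)_{n \ge 1}$. Then $(X_n)_{n\ge 0}$ is transient, i.e. it is not weakly recurrent: \[ \mathbb{P}\bigl(\text{there is } C < \infty \text{ such that } |X_n| \le C \text{ for infinitely many } n\bigr) \neq 1 . \] -/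

import Mathlib

open MeasureTheory ProbabilityTheory Filter

/-- The family `ε` consists of i.i.d. Rademacher random variables under `μ`: they are measurable
and mutually independent, and each takes the values `1` and `-1` with probability `1/2` each. -/
structure IsRademacherFamily {ι Ω : Type*} [MeasurableSpace Ω] (μ : Measure Ω)
    (ε : ι → Ω → ℝ) : Prop where
  measurable : ∀ k, Measurable (ε k)
  indep : iIndepFun ε μ
  prob_one : ∀ k, μ {ω | ε k ω = 1} = 1 / 2
  prob_neg_one : ∀ k, μ {ω | ε k ω = -1} = 1 / 2

/-- The Rademacher walk `X_n = ε_1 a_1 + ⋯ + ε_n a_n`. The step sizes are `a 1, a 2, …`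
(the value `a 0` is not used), and the signs are listed from index zero, so that `ε k` is the
sign of the step of size `a (k + 1)`. -/
def rademacherWalk {Ω : Type*} (ε : ℕ → Ω → ℝ) (a : ℕ → ℝ) (n : ℕ) (ω : Ω) : ℝ :=
  ∑ k ∈ Finset.range n, ε k ω * a (k + 1)

/-- A walk is weakly recurrent if the event `{∃ C, |X_n| ≤ C infinitely often}` has
probability one. -/
def IsWeaklyRecurrent {Ω : Type*} [MeasurableSpace Ω] (μ : Measure Ω) (X : ℕ → Ω → ℝ) : Prop :=
  μ {ω | ∃ C : ℝ, ∃ᶠ n in atTop, |X n ω| ≤ C} = 1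

/-- A walk is transient if it is not weakly recurrent. -/
def IsTransient {Ω : Type*} [MeasurableSpace Ω] (μ : Measure Ω) (X : ℕ → Ω → ℝ) : Prop :=
  ¬ IsWeaklyRecurrent μ X

/-! Put `β = α⁻¹ < 1` and cut time into blocks on which the step size is a constant `m`. With `u =
exp ((m + 1) ^ β)`, the `m`-th block ends near time `u` and has length at most of order `m ^ (β - 1)
* u`. At its end the walk has variance of order `m ^ 2 * u`, so a local limit heuristic suggests
that each integer is hit there with probability `O(1 / (m * √u))`. This is proved with
characteristic functions (`eventually_prob_walk_eq_le`).

If the walk visits `[-C, C]` during the block, then from the first visit on it moves by multiples of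
`m`, typically by at most about the square root of the block length many. The end point thus lies in
a set of `O(C * √(m ^ (β - 1) * u))` integers (`prob_exists_abs_walk_le`). Hence a visit in block
`m` has probability `O(m ^ ((β - 1) / 2 - 1))`, which is summable because `β < 1`, and
Borel–Cantelli excludes infinitely many visits. -/

/-! ### Fourier inversion for integer-valued laws -/

lemma integral_exp_int_mul_I (k : ℤ) :
    ∫ t in (-Real.pi)..Real.pi, Complex.exp (t * k * Complex.I) =
      if k = 0 then 2 * (Real.pi : ℂ) else 0 := by
  split_ifs with h
  · subst h; simp [two_mul]
  · have hc : (k : ℂ) * Complex.I ≠ 0 := by simp [h]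
    have h1 := integral_exp_mul_complex (a := -Real.pi) (b := Real.pi) hc
    have h2 : ∀ t : ℝ, Complex.exp (t * k * Complex.I) = Complex.exp (k * Complex.I * t) :=
      fun t => by ring_nf
    simp_rw [h2, h1]
    have h3 : Complex.exp (k * Complex.I * (Real.pi : ℝ)) =
        Complex.exp (k * Complex.I * ((-Real.pi : ℝ) : ℂ)) := by
      rw [Complex.exp_eq_exp_iff_exists_int]
      exact ⟨k, by push_cast; ring⟩
    rw [h3, sub_self, zero_div]

/-- Orthogonality of the characters and Fubini recover the atom at `y` from `charFun ν`; the phase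
`exp (-i t y)` disappears in the modulus, so the bound is uniform in `y`. -/
lemma measureReal_singleton_le_integral_norm_charFun (ν : Measure ℝ) [IsProbabilityMeasure ν]
    (hν : ∀ᵐ x : ℝ ∂ν, ∃ z : ℤ, x = z) (y : ℤ) :
    ν.real {(y : ℝ)} ≤ (2 * Real.pi)⁻¹ * ∫ t in (-Real.pi)..Real.pi, ‖charFun ν t‖ := by
  have hle : -Real.pi ≤ Real.pi := by linarith [Real.pi_pos]
  have hswap : ∫ t in (-Real.pi)..Real.pi, ∫ x, Complex.exp (t * (x - y) * Complex.I) ∂ν =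
      ∫ x, (∫ t in (-Real.pi)..Real.pi, Complex.exp (t * (x - y) * Complex.I)) ∂ν := by
    apply intervalIntegral_integral_swap
    have hfin : IsFiniteMeasure (volume.restrict (Set.uIoc (-Real.pi) Real.pi)) := by
      refine ⟨?_⟩
      rw [Measure.restrict_apply_univ, Set.uIoc_of_le hle]
      simp
    refine Integrable.mono' (integrable_const (1 : ℝ)) ?_ ?_
    · apply Continuous.aestronglyMeasurable
      unfold Function.uncurry
      fun_prop
    · refine Eventually.of_forall fun p => ?_
      have : ((p.1 : ℂ) * (p.2 - y)) = ((p.1 * (p.2 - y) : ℝ) : ℂ) := by push_cast; rfl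
      simp only [Function.uncurry, this, Complex.norm_exp_ofReal_mul_I, le_refl]
  have hright : ∫ x, (∫ t in (-Real.pi)..Real.pi, Complex.exp (t * (x - y) * Complex.I)) ∂ν =
      2 * Real.pi * ν.real {(y : ℝ)} := by
    have : (fun x : ℝ => ∫ t in (-Real.pi)..Real.pi, Complex.exp (t * (x - y) * Complex.I)) =ᵐ[ν]
        Set.indicator {(y : ℝ)} (fun _ => 2 * (Real.pi : ℂ)) := by
      filter_upwards [hν] with x ⟨z, hz⟩
      have h1 := integral_exp_int_mul_I (z - y)
      push_cast at h1
      subst hz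
      simp only [Complex.ofReal_intCast]
      rw [h1]
      by_cases h : z = y
      · simp [h]
      · have : ((z : ℝ)) ∉ ({(y : ℝ)} : Set ℝ) := by simpa using h
        rw [Set.indicator_of_notMem this, if_neg (by omega)]
    rw [integral_congr_ae this, integral_indicator_const _ (measurableSet_singleton _)]
    simp [mul_comm]
  have hleft : ∀ t : ℝ, ‖∫ x, Complex.exp (t * (x - y) * Complex.I) ∂ν‖ = ‖charFun ν t‖ := by
    intro t
    have : ∀ x : ℝ, Complex.exp (t * (x - y) * Complex.I) =
        Complex.exp (t * x * Complex.I) * Complex.exp ((-(t * y) : ℝ) * Complex.I) := by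
      intro x
      rw [← Complex.exp_add]
      push_cast
      ring_nf
    simp_rw [this]
    rw [integral_mul_const, norm_mul, Complex.norm_exp_ofReal_mul_I, mul_one, charFun_apply_real]
  have hnorm := intervalIntegral.norm_integral_le_integral_norm
    (f := fun t : ℝ => ∫ x, Complex.exp (t * (x - y) * Complex.I) ∂ν) (μ := volume) hle
  rw [hswap, hright] at hnorm
  simp_rw [hleft] at hnorm
  have h2 : ‖(2 * Real.pi * ν.real {(y : ℝ)} : ℂ)‖ = 2 * Real.pi * ν.real {(y : ℝ)} := by
    rw [show (2 * Real.pi * ν.real {(y : ℝ)} : ℂ) = ((2 * Real.pi * ν.real {(y : ℝ)} : ℝ) : ℂ) by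
      push_cast; rfl, Complex.norm_real, Real.norm_of_nonneg (by positivity)]
  rw [h2] at hnorm
  rw [inv_mul_eq_div, le_div_iff₀ (by positivity)]
  linarith

/-! ### Rademacher signs and the characteristic function of the walk -/

namespace IsRademacherFamily

variable {Ω : Type*} [MeasurableSpace Ω] {μ : Measure Ω}

lemma measurable_walk {ε : ℕ → Ω → ℝ} (hε : IsRademacherFamily μ ε) (a : ℕ → ℝ) (n : ℕ) :
    Measurable (rademacherWalk ε a n) := by
  have := hε.measurable
  unfold rademacherWalk
  fun_prop

variable [IsProbabilityMeasure μ]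

lemma ae_eq_one_or {ι : Type*} {ε : ι → Ω → ℝ} (hε : IsRademacherFamily μ ε) (k : ι) :
    ∀ᵐ ω ∂μ, ε k ω = 1 ∨ ε k ω = -1 := by
  have h1 : MeasurableSet {ω | ε k ω = 1} := hε.measurable k (measurableSet_singleton 1)
  have h2 : MeasurableSet {ω | ε k ω = -1} := hε.measurable k (measurableSet_singleton (-1))
  have hd : Disjoint {ω | ε k ω = 1} {ω | ε k ω = -1} := by
    rw [Set.disjoint_left]
    intro ω (h : ε k ω = 1) (h' : ε k ω = -1)
    linarith
  have hu := measure_union (μ := μ) hd h2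
  rw [hε.prob_one, hε.prob_neg_one, ENNReal.add_halves] at hu
  have := (prob_compl_eq_zero_iff (h1.union h2)).2 hu
  exact this

lemma integral_comp {ι : Type*} {ε : ι → Ω → ℝ} (hε : IsRademacherFamily μ ε) (k : ι)
    {E : Type*} [NormedAddCommGroup E] [NormedSpace ℝ E] [CompleteSpace E] (g : ℝ → E) :
    ∫ ω, g (ε k ω) ∂μ = (2 : ℝ)⁻¹ • g 1 + (2 : ℝ)⁻¹ • g (-1) := by
  have h1 : MeasurableSet {ω | ε k ω = 1} := hε.measurable k (measurableSet_singleton 1)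
  have h2 : MeasurableSet {ω | ε k ω = -1} := hε.measurable k (measurableSet_singleton (-1))
  have : (fun ω => g (ε k ω)) =ᵐ[μ] fun ω => Set.indicator {ω | ε k ω = 1} (fun _ => g 1) ω +
      Set.indicator {ω | ε k ω = -1} (fun _ => g (-1)) ω := by
    filter_upwards [hε.ae_eq_one_or k] with ω h
    rcases h with h | h
    · rw [Set.indicator_of_mem (show ω ∈ {ω | ε k ω = 1} from h), Set.indicator_of_notMem, h,
        add_zero]
      simp only [Set.mem_ofPred_eq, h]; norm_num
    · rw [Set.indicator_of_mem (show ω ∈ {ω | ε k ω = -1} from h), Set.indicator_of_notMem, h,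
        zero_add]
      simp only [Set.mem_ofPred_eq, h]; norm_num
  rw [integral_congr_ae this, integral_add, integral_indicator_const _ h1,
    integral_indicator_const _ h2]
  · simp [Measure.real, hε.prob_one, hε.prob_neg_one]
  · exact (integrable_const _).indicator h1
  · exact (integrable_const _).indicator h2

lemma charFun_map_mul {ι : Type*} {ε : ι → Ω → ℝ} (hε : IsRademacherFamily μ ε) (k : ι)
    (c t : ℝ) : charFun (μ.map fun ω => ε k ω * c) t = (Real.cos (c * t) : ℂ) := by
  have := hε.measurable k
  rw [charFun_apply_real, integral_map (by fun_prop) (by fun_prop),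
    hε.integral_comp k fun x => Complex.exp (t * ((x * c : ℝ) : ℂ) * Complex.I)]
  rw [Complex.ofReal_cos, Complex.cos]
  simp only [Complex.real_smul]
  push_cast
  ring_nf

lemma norm_charFun_map_walk {ε : ℕ → Ω → ℝ} (hε : IsRademacherFamily μ ε) (a : ℕ → ℝ)
    (n : ℕ) (t : ℝ) :
    ‖charFun (μ.map (rademacherWalk ε a n)) t‖ =
      ∏ k ∈ Finset.range n, |Real.cos (a (k + 1) * t)| := by
  have hm := hε.measurable
  have hind : iIndepFun (fun k ω => ε k ω * a (k + 1)) μ :=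
    hε.indep.comp (fun k x => x * a (k + 1)) (fun k => by fun_prop)
  have h := iIndepFun.charFun_map_fun_finsetSum_eq_prod (P := μ) (s := Finset.range n)
    (X := fun k ω => ε k ω * a (k + 1)) (fun i _ => by fun_prop)
    (hind.precomp (g := ((↑) : Finset.range n → ℕ)) Subtype.val_injective)
  unfold rademacherWalk
  rw [h, Finset.prod_apply, norm_prod]
  refine Finset.prod_congr rfl fun k _ => ?_
  rw [hε.charFun_map_mul, Complex.norm_real, Real.norm_eq_abs]

lemma ae_walk_int {ε : ℕ → Ω → ℝ} (hε : IsRademacherFamily μ ε) (a : ℕ → ℕ) :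
    ∀ᵐ ω ∂μ, ∀ n, ∃ z : ℤ, rademacherWalk ε (fun k => (a k : ℝ)) n ω = z := by
  filter_upwards [ae_all_iff.2 hε.ae_eq_one_or] with ω h n
  choose s hs using fun k => (show ∃ s : ℤ, ε k ω = s from
    (h k).elim (fun h => ⟨1, by simpa using h⟩) (fun h => ⟨-1, by simpa using h⟩))
  exact ⟨∑ k ∈ Finset.range n, s k * a (k + 1), by simp [rademacherWalk, hs]⟩

/-- A local bound on the law of the walk by the integral of the modulus of its characteristic
function. -/
lemma measureReal_walk_eq_le {ε : ℕ → Ω → ℝ} (hε : IsRademacherFamily μ ε) (a : ℕ → ℕ)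
    (n : ℕ) (y : ℤ) :
    μ.real {ω | rademacherWalk ε (fun k => (a k : ℝ)) n ω = y} ≤
      (2 * Real.pi)⁻¹ * ∫ t in (-Real.pi)..Real.pi,
        ∏ k ∈ Finset.range n, |Real.cos (a (k + 1) * t)| := by
  have hm := hε.measurable_walk (fun k => (a k : ℝ)) n
  have : IsProbabilityMeasure (μ.map (rademacherWalk ε (fun k => (a k : ℝ)) n)) :=
    Measure.isProbabilityMeasure_map hm.aemeasurable
  have h := measureReal_singleton_le_integral_norm_charFun
    (μ.map (rademacherWalk ε (fun k => (a k : ℝ)) n)) (by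
      have hS : MeasurableSet {x : ℝ | ∃ z : ℤ, x = z} := by
        have : {x : ℝ | ∃ z : ℤ, x = z} = Set.range ((↑) : ℤ → ℝ) := by
          ext; simp [eq_comm]
        rw [this]
        exact (Set.countable_range _).measurableSet
      rw [ae_map_iff hm.aemeasurable hS]
      filter_upwards [hε.ae_walk_int a] with ω h using h n) y
  simp_rw [hε.norm_charFun_map_walk] at h
  rwa [map_measureReal_apply hm (measurableSet_singleton _)] at h

end IsRademacherFamily

/-! ### Second moments and visits during a constant-step stretch -/

namespace IsRademacherFamily

variable {Ω : Type*} [MeasurableSpace Ω] {μ : Measure Ω} [IsProbabilityMeasure μ]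

lemma memLp_two {ι : Type*} {ε : ι → Ω → ℝ} (hε : IsRademacherFamily μ ε) (k : ι) :
    MemLp (ε k) 2 μ := by
  refine MemLp.of_bound (hε.measurable k).aestronglyMeasurable 1 ?_
  filter_upwards [hε.ae_eq_one_or k] with ω h
  rcases h with h | h <;> simp [h]

lemma variance_eq_one {ι : Type*} {ε : ι → Ω → ℝ} (hε : IsRademacherFamily μ ε) (k : ι) :
    variance (ε k) μ = 1 := by
  rw [variance_eq_sub (hε.memLp_two k)]
  have h1 := hε.integral_comp k (fun x : ℝ => x)
  have h2 := hε.integral_comp k (fun x : ℝ => x ^ 2)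
  simp only [Pi.pow_apply]
  rw [h1, h2]
  norm_num

lemma prob_le_abs_sum_le {ι : Type*} {ε : ι → Ω → ℝ} (hε : IsRademacherFamily μ ε)
    (s : Finset ι) {c : ℝ} (hc : 0 < c) :
    μ.real {ω | c ≤ |∑ k ∈ s, ε k ω|} ≤ s.card / c ^ 2 := by
  have hmem : MemLp (∑ k ∈ s, ε k) 2 μ := memLp_finsetSum' s fun k _ => hε.memLp_two k
  have hint : ∫ ω, (∑ k ∈ s, ε k) ω ∂μ = 0 := by
    simp only [Finset.sum_apply]
    rw [integral_finsetSum _ fun k _ => (hε.memLp_two k).integrable one_le_two]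
    refine Finset.sum_eq_zero fun k _ => ?_
    rw [hε.integral_comp k (fun x : ℝ => x)]
    norm_num
  have hvar : variance (∑ k ∈ s, ε k) μ = s.card := by
    rw [IndepFun.variance_sum (fun k _ => hε.memLp_two k)
      fun i _ j _ hij => hε.indep.indepFun hij]
    simp [hε.variance_eq_one]
  have h := meas_ge_le_variance_div_sq hmem hc
  rw [hint, hvar] at h
  simp only [Finset.sum_apply, sub_zero] at h
  exact ENNReal.toReal_le_of_le_ofReal (by positivity) h

/-- If the walk enters `[-C, C]` during a stretch of steps of constant size `m`, then with
conditional probability at least `3 / 4` it is, at the end of the stretch, at one of the points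
`r + m s` with `|r| ≤ C` and `|s| ≤ R`. -/
lemma prob_exists_abs_walk_le {ε : ℕ → Ω → ℝ} (hε : IsRademacherFamily μ ε) (a : ℕ → ℕ)
    {N M m C R : ℕ} {p : ℝ} (hR : 4 * (M - N) ≤ R ^ 2)
    (ha : ∀ k, N ≤ k → k < M → a (k + 1) = m)
    (hp : ∀ y : ℤ, μ.real {ω | rademacherWalk ε (fun k => (a k : ℝ)) M ω = y} ≤ p) :
    μ.real {ω | ∃ n, N ≤ n ∧ n ≤ M ∧ |rademacherWalk ε (fun k => (a k : ℝ)) n ω| ≤ C} ≤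
      4 / 3 * ((2 * C + 1) * (2 * R + 1) * p) := by
  set X := rademacherWalk ε (fun k => (a k : ℝ))
  -- `F n`: the first visit after `N` is at time `n`, an event of the signs before `n`. `G n`: the
  -- remaining signs have a small sum, an event of the signs from `n` on. So the two are
  -- independent.
  let F : ℕ → Set Ω := fun n => {ω | |X n ω| ≤ C ∧ ∀ j ∈ Finset.Ico N n, C < |X j ω|}
  let G : ℕ → Set Ω := fun n => {ω | |∑ k ∈ Finset.Ico n M, ε k ω| < R + 1}
  let 𝓕 : ℕ → MeasurableSpace Ω := fun i => MeasurableSpace.comap (ε i) inferInstance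
  have h𝓕 : ∀ i, 𝓕 i ≤ ‹MeasurableSpace Ω› := fun i => (hε.measurable i).comap_le
  have hεS : ∀ (S : Set ℕ) (i : ℕ), i ∈ S → Measurable[⨆ i ∈ S, 𝓕 i] (ε i) := fun S i hi =>
    (comap_measurable (ε i)).mono (le_biSup 𝓕 hi) le_rfl
  have hXS : ∀ n j, j ≤ n → Measurable[⨆ i ∈ Set.Iio n, 𝓕 i] (X j) := by
    intro n j hj
    refine Finset.measurable_fun_sum _ fun k hk => ?_
    exact (hεS _ k (by simp at hk ⊢; omega)).mul_const _
  have hFS : ∀ n, MeasurableSet[⨆ i ∈ Set.Iio n, 𝓕 i] (F n) := by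
    intro n
    have e : F n = {ω | |X n ω| ≤ C} ∩ ⋂ j ∈ Finset.Ico N n, {ω | C < |X j ω|} := by
      ext ω; simp [F]
    rw [e]
    refine MeasurableSet.inter ?_ (Finset.measurableSet_biInter _ fun j hj => ?_)
    · exact hXS n n le_rfl (measurableSet_le (g := fun _ => (C : ℝ)) measurable_id.abs measurable_const)
    · have hj' : j ≤ n := by simp at hj; omega
      exact hXS n j hj' (measurableSet_lt (f := fun _ => (C : ℝ)) measurable_const measurable_id.abs)
  have hGS : ∀ n, MeasurableSet[⨆ i ∈ Set.Ici n, 𝓕 i] (G n) := by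
    intro n
    have h : Measurable[⨆ i ∈ Set.Ici n, 𝓕 i] fun ω => ∑ k ∈ Finset.Ico n M, ε k ω :=
      Finset.measurable_fun_sum _ fun k hk => hεS _ k (by simp at hk ⊢; omega)
    exact h (measurableSet_lt (g := fun _ => (R : ℝ) + 1) measurable_id.abs measurable_const)
  have hle : ∀ S : Set ℕ, (⨆ i ∈ S, 𝓕 i) ≤ ‹MeasurableSpace Ω› := fun S =>
    iSup₂_le fun i _ => h𝓕 i
  have hF : ∀ n, MeasurableSet (F n) := fun n => hle _ _ (hFS n)
  have hG : ∀ n, MeasurableSet (G n) := fun n => hle _ _ (hGS n)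
  have hindep : ∀ n, μ.real (F n ∩ G n) = μ.real (F n) * μ.real (G n) := by
    intro n
    have hd : Disjoint (Set.Iio n) (Set.Ici n) := by
      rw [Set.disjoint_left]; intro i h h'; simp at h h'; omega
    have := (Indep_iff _ _ μ).1 (indep_iSup_of_disjoint h𝓕 hε.indep hd) _ _ (hFS n) (hGS n)
    simp [Measure.real, this]
  -- Chebyshev: the remaining sum has variance at most `M - N ≤ R ^ 2 / 4`.
  have hGp : ∀ n, N ≤ n → 3 / 4 ≤ μ.real (G n) := by
    intro n hn
    have h := hε.prob_le_abs_sum_le (Finset.Ico n M) (c := (R : ℝ) + 1) (by positivity)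
    have hc : {ω | (R : ℝ) + 1 ≤ |∑ k ∈ Finset.Ico n M, ε k ω|} = (G n)ᶜ := by
      ext ω; simp [G]
    rw [hc, probReal_compl_eq_one_sub (hG n), Nat.card_Ico, le_div_iff₀ (by positivity)] at h
    have h1 : 4 * ((M - n : ℕ) : ℝ) ≤ (R : ℝ) ^ 2 := by
      exact_mod_cast le_trans (by omega) hR
    by_contra hlt
    push Not at hlt
    nlinarith [sq_nonneg ((R : ℝ)), Nat.cast_nonneg (α := ℝ) R]
  have hdisj : ∀ i j, i < j → N ≤ i → Disjoint (F i) (F j) := by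
    intro i j hij hi
    rw [Set.disjoint_left]
    intro ω h h'
    exact absurd h.1 (not_le.2 (h'.2 i (by simp; omega)))
  have hpair : Set.PairwiseDisjoint (Finset.Icc N M : Set ℕ) F := by
    intro i hi j hj hij
    simp at hi hj
    rcases lt_or_gt_of_ne hij with h | h
    · exact hdisj i j h hi.1
    · exact (hdisj j i h hj.1).symm
  have hA : {ω | ∃ n, N ≤ n ∧ n ≤ M ∧ |X n ω| ≤ C} ⊆ ⋃ n ∈ Finset.Icc N M, F n := by
    intro ω hω
    classical
    obtain ⟨h1, h2, h3⟩ := Nat.find_spec hω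
    simp only [Set.mem_iUnion, Finset.mem_Icc]
    refine ⟨Nat.find hω, ⟨h1, h2⟩, h3, fun j hj => ?_⟩
    rw [Finset.mem_Ico] at hj
    by_contra hlt
    exact Nat.find_min hω hj.2 ⟨hj.1, by omega, not_lt.1 hlt⟩
  -- `H` collects the possible end points `r + m * s`; `hp` bounds each one separately.
  let T : Finset (ℤ × ℤ) := Finset.Icc (-(C : ℤ)) C ×ˢ Finset.Icc (-(R : ℤ)) R
  let H : Set Ω := ⋃ q ∈ T, {ω | X M ω = ((q.1 + m * q.2 : ℤ) : ℝ)}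
  have hHp : μ.real H ≤ (2 * C + 1) * (2 * R + 1) * p := by
    refine (measureReal_biUnion_finset_le _ _).trans ?_
    refine (Finset.sum_le_card_nsmul _ _ p fun q _ => hp _).trans ?_
    rw [Finset.card_product, Int.card_Icc, Int.card_Icc, nsmul_eq_mul]
    rw [show ((C : ℤ) + 1 - -C).toNat = 2 * C + 1 by omega,
      show ((R : ℤ) + 1 - -R).toNat = 2 * R + 1 by omega]
    push_cast
    rfl
  have hsub : ∀ᵐ ω ∂μ, ω ∈ (⋃ n ∈ Finset.Icc N M, F n ∩ G n) → ω ∈ H := by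
    -- The walk with unit steps shows that sums of signs are integers, so `< R + 1` means `≤ R`.
    filter_upwards [hε.ae_walk_int a, hε.ae_walk_int (fun _ => 1)] with ω hz hz1 hω
    simp only [Set.mem_iUnion, Finset.mem_Icc] at hω
    obtain ⟨n, ⟨hN, hM⟩, hFn, hGn⟩ := hω
    obtain ⟨r, hr⟩ := hz n
    obtain ⟨u, hu⟩ := hz1 n
    obtain ⟨v, hv⟩ := hz1 M
    have hs : ∑ k ∈ Finset.Ico n M, ε k ω = ((v - u : ℤ) : ℝ) := by
      rw [Finset.sum_Ico_eq_sub _ hM]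
      simp [rademacherWalk] at hu hv
      rw [hu, hv]; push_cast; rfl
    have hXM : X M ω = ((r + m * (v - u) : ℤ) : ℝ) := by
      have h1 : X M ω - X n ω = ∑ k ∈ Finset.Ico n M, ε k ω * a (k + 1) := by
        rw [Finset.sum_Ico_eq_sub _ hM]; rfl
      have h2 : ∑ k ∈ Finset.Ico n M, ε k ω * a (k + 1) =
          (∑ k ∈ Finset.Ico n M, ε k ω) * m := by
        rw [Finset.sum_mul]
        refine Finset.sum_congr rfl fun k hk => ?_
        rw [Finset.mem_Ico] at hk
        rw [ha k (by omega) hk.2]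
      rw [h2, hs] at h1
      change X n ω = r at hr
      push_cast at h1 ⊢
      linarith
    have hrC : |r| ≤ C := by
      have := hFn.1
      change X n ω = r at hr
      rw [hr] at this
      exact_mod_cast this
    have hsR : |v - u| < R + 1 := by
      have : |∑ k ∈ Finset.Ico n M, ε k ω| < R + 1 := hGn
      rw [hs] at this
      exact_mod_cast this
    simp only [H, Set.mem_iUnion]
    refine ⟨(r, v - u), ?_, hXM⟩
    simp only [T, Finset.mem_product, Finset.mem_Icc]
    exact ⟨abs_le.1 hrC, abs_le.1 (by omega)⟩
  have h1 : μ.real (⋃ n ∈ Finset.Icc N M, F n ∩ G n) ≤ μ.real H :=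
    ENNReal.toReal_mono (measure_ne_top _ _) (measure_mono_ae hsub)
  rw [measureReal_biUnion_finset (fun i hi j hj hij =>
    (hpair hi hj hij).mono Set.inter_subset_left Set.inter_subset_left)
    fun n _ => (hF n).inter (hG n)] at h1
  have h2 : μ.real {ω | ∃ n, N ≤ n ∧ n ≤ M ∧ |X n ω| ≤ C} ≤
      ∑ n ∈ Finset.Icc N M, μ.real (F n) :=
    (measureReal_mono hA (measure_ne_top _ _)).trans (measureReal_biUnion_finset_le _ _)
  have h3 : (3 / 4) * ∑ n ∈ Finset.Icc N M, μ.real (F n) ≤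
      ∑ n ∈ Finset.Icc N M, μ.real (F n ∩ G n) := by
    rw [Finset.mul_sum]
    refine Finset.sum_le_sum fun n hn => ?_
    rw [hindep n, mul_comm]
    exact mul_le_mul_of_nonneg_left (hGp n (Finset.mem_Icc.1 hn).1) measureReal_nonneg
  linarith

end IsRademacherFamily

/-! ### Bounds for the product of cosines -/

lemma abs_cos_le_exp_neg_sin_sq (x : ℝ) : |Real.cos x| ≤ Real.exp (-(Real.sin x ^ 2 / 2)) := by
  have h1 : Real.cos x ^ 2 ≤ Real.exp (-(Real.sin x ^ 2)) := by
    have := Real.add_one_le_exp (-(Real.sin x ^ 2))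
    nlinarith [Real.sin_sq_add_cos_sq x]
  have h2 : Real.exp (-(Real.sin x ^ 2)) = Real.exp (-(Real.sin x ^ 2 / 2)) ^ 2 := by
    rw [← Real.exp_nat_mul]; push_cast; ring_nf
  rw [h2, ← sq_abs] at h1
  exact le_of_sq_le_sq h1 (Real.exp_pos _).le

lemma prod_abs_cos_le_exp_neg_sum_sin_sq (s : Finset ℕ) (g : ℕ → ℝ) :
    ∏ k ∈ s, |Real.cos (g k)| ≤ Real.exp (-(∑ k ∈ s, Real.sin (g k) ^ 2) / 2) := by
  calc ∏ k ∈ s, |Real.cos (g k)| ≤ ∏ k ∈ s, Real.exp (-(Real.sin (g k) ^ 2 / 2)) :=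
        Finset.prod_le_prod (fun _ _ => abs_nonneg _) fun k _ => abs_cos_le_exp_neg_sin_sq _
    _ = _ := by
        rw [← Real.exp_sum, Finset.sum_neg_distrib, ← Finset.sum_div, neg_div]

/-- For `m * |t| ≤ π / 2` all angles are in the range where `|sin x| ≥ 2 * |x| / π`, which gives
Gaussian decay. For larger `t` the two consecutive step sizes `m - 1` and `m` help: `t = m * t - (m
- 1) * t`, so the sines of both angles cannot be small when `sin t` is not. The hypothesis `hL` asks
that both sizes occur at least `L` times. -/
lemma prod_abs_cos_le {a : ℕ → ℕ} {M m : ℕ} {V L : ℝ} (hm : 1 ≤ m)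
    (ham : ∀ k < M, a (k + 1) ≤ m) (hV : V ≤ ∑ k ∈ Finset.range M, (a (k + 1) : ℝ) ^ 2)
    (hL : ∀ i, m ≤ i + 1 → i ≤ m → L ≤ ((Finset.range M).filter fun k => a (k + 1) = i).card)
    {t : ℝ} (ht : |t| ≤ Real.pi / 2) :
    ∏ k ∈ Finset.range M, |Real.cos (a (k + 1) * t)| ≤
      Real.exp (-(2 / Real.pi ^ 2 * V) * t ^ 2) + Real.exp (-(L / (8 * m ^ 2))) := by
  have hpi := Real.pi_pos
  have hm0 : (0 : ℝ) < m := by exact_mod_cast hm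
  refine (prod_abs_cos_le_exp_neg_sum_sin_sq _ _).trans ?_
  rcases le_or_gt (m * |t|) (Real.pi / 2) with h | h
  · refine le_add_of_le_of_nonneg (Real.exp_le_exp.2 ?_) (Real.exp_pos _).le
    have h1 : ∀ k ∈ Finset.range M, (4 / Real.pi ^ 2 * t ^ 2) * (a (k + 1) : ℝ) ^ 2 ≤
        Real.sin (a (k + 1) * t) ^ 2 := by
      intro k hk
      have h2 : |(a (k + 1) : ℝ) * t| ≤ Real.pi / 2 := by
        rw [abs_mul, Nat.abs_cast]
        refine le_trans ?_ h
        gcongr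
        exact_mod_cast ham k (Finset.mem_range.1 hk)
      have h3 := pow_le_pow_left₀ (by positivity) (Real.mul_abs_le_abs_sin h2) 2
      rw [mul_pow, sq_abs, sq_abs] at h3
      refine le_trans (le_of_eq ?_) h3
      ring
    have h4 := Finset.sum_le_sum h1
    rw [← Finset.mul_sum] at h4
    have h5 : (4 / Real.pi ^ 2 * t ^ 2) * V ≤
        (4 / Real.pi ^ 2 * t ^ 2) * ∑ k ∈ Finset.range M, (a (k + 1) : ℝ) ^ 2 := by gcongr
    have h6 : (4 / Real.pi ^ 2 * t ^ 2) * V = 2 * (2 / Real.pi ^ 2 * V * t ^ 2) := by ring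
    linarith
  · refine le_add_of_nonneg_of_le (Real.exp_pos _).le (Real.exp_le_exp.2 ?_)
    -- Here `|t| > π / (2 * m)`, and Jordan's inequality applies because `|t| ≤ π / 2`.
    have hsin : 1 / (m : ℝ) ≤ |Real.sin t| := by
      refine le_trans ?_ (Real.mul_abs_le_abs_sin ht)
      rw [div_mul_eq_mul_div, div_le_div_iff₀ hm0 hpi]
      linarith
    obtain ⟨i, hi1, hi2, hi⟩ : ∃ i, m ≤ i + 1 ∧ i ≤ m ∧ 1 / (2 * (m : ℝ)) ≤ |Real.sin (i * t)| := by
      by_contra! hcon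
      have h1 := hcon m (by omega) le_rfl
      have h2 := hcon (m - 1) (by omega) (by omega)
      have h3 : Real.sin t = Real.sin (m * t) * Real.cos ((m - 1 : ℕ) * t) -
          Real.cos (m * t) * Real.sin ((m - 1 : ℕ) * t) := by
        rw [← Real.sin_sub]
        push_cast [hm]
        ring_nf
      have h4 : |Real.sin t| ≤ |Real.sin (m * t)| + |Real.sin ((m - 1 : ℕ) * t)| := by
        rw [h3]
        refine (abs_sub _ _).trans (add_le_add ?_ ?_)
        · rw [abs_mul]
          exact mul_le_of_le_one_right (abs_nonneg _) (Real.abs_cos_le_one _)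
        · rw [abs_mul]
          exact mul_le_of_le_one_left (abs_nonneg _) (Real.abs_cos_le_one _)
      have h5 : 1 / (m : ℝ) = 1 / (2 * (m : ℝ)) + 1 / (2 * (m : ℝ)) := by field_simp; norm_num
      linarith
    have hsq : 1 / (4 * (m : ℝ) ^ 2) ≤ Real.sin (i * t) ^ 2 := by
      have := pow_le_pow_left₀ (by positivity) hi 2
      rw [sq_abs] at this
      refine le_trans (le_of_eq ?_) this
      field_simp; norm_num
    have h7 : L * (1 / (4 * (m : ℝ) ^ 2)) ≤
        ∑ k ∈ Finset.range M, Real.sin (a (k + 1) * t) ^ 2 := by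
      calc L * (1 / (4 * (m : ℝ) ^ 2))
          ≤ (((Finset.range M).filter fun k => a (k + 1) = i).card : ℝ) *
            (1 / (4 * (m : ℝ) ^ 2)) := by
            gcongr
            exact hL i hi1 hi2
        _ ≤ ∑ k ∈ (Finset.range M).filter (fun k => a (k + 1) = i),
              Real.sin (a (k + 1) * t) ^ 2 := by
            rw [← nsmul_eq_mul]
            refine Finset.card_nsmul_le_sum _ _ _ fun k hk => ?_
            rw [(Finset.mem_filter.1 hk).2]
            exact hsq
        _ ≤ _ := Finset.sum_le_sum_of_subset_of_nonneg (Finset.filter_subset _ _)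
            fun _ _ _ => sq_nonneg _
    have h8 : L / (8 * (m : ℝ) ^ 2) = L * (1 / (4 * (m : ℝ) ^ 2)) / 2 := by ring
    linarith

lemma integral_prod_abs_cos_le {a : ℕ → ℕ} {M m : ℕ} {V L : ℝ} (hm : 1 ≤ m) (hV0 : 0 < V)
    (ham : ∀ k < M, a (k + 1) ≤ m) (hV : V ≤ ∑ k ∈ Finset.range M, (a (k + 1) : ℝ) ^ 2)
    (hL : ∀ i, m ≤ i + 1 → i ≤ m → L ≤ ((Finset.range M).filter fun k => a (k + 1) = i).card) :
    (2 * Real.pi)⁻¹ * ∫ t in (-Real.pi)..Real.pi,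
        ∏ k ∈ Finset.range M, |Real.cos (a (k + 1) * t)| ≤
      √(Real.pi / (2 * V)) + Real.exp (-(L / (8 * m ^ 2))) := by
  have hpi := Real.pi_pos
  set P : ℝ → ℝ := fun t => ∏ k ∈ Finset.range M, |Real.cos (a (k + 1) * t)| with hP
  have hcont : Continuous P := by fun_prop
  -- Integer steps give period `π` for the modulus, so `|t| ≤ π / 2` suffices; this avoids the zeros
  -- of `sin t` at `±π`.
  have hper : Function.Periodic P Real.pi := by
    intro t
    refine Finset.prod_congr rfl fun k _ => ?_
    rw [mul_add, Real.cos_add_nat_mul_pi, abs_mul, abs_pow, abs_neg, abs_one, one_pow,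
      one_mul]
  have hii : ∀ u v, IntervalIntegrable P volume u v := fun u v => hcont.intervalIntegrable u v
  have hhalf : ∫ t in (-Real.pi)..Real.pi, P t = 2 * ∫ t in (-(Real.pi / 2))..(Real.pi / 2), P t := by
    rw [← intervalIntegral.integral_add_adjacent_intervals (hii (-Real.pi) 0) (hii 0 Real.pi)]
    have h1 := hper.intervalIntegral_add_eq (-Real.pi) (-(Real.pi / 2))
    have h2 := hper.intervalIntegral_add_eq 0 (-(Real.pi / 2))
    rw [show -Real.pi + Real.pi = 0 by ring, show -(Real.pi / 2) + Real.pi = Real.pi / 2 by ring]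
      at h1
    rw [zero_add, show -(Real.pi / 2) + Real.pi = Real.pi / 2 by ring] at h2
    rw [h1, h2]; ring
  have hb : 0 < 2 / Real.pi ^ 2 * V := by positivity
  have hgi : Integrable fun t : ℝ => Real.exp (-(2 / Real.pi ^ 2 * V) * t ^ 2) :=
    integrable_exp_neg_mul_sq hb
  have hle : ∫ t in (-(Real.pi / 2))..(Real.pi / 2), P t ≤
      ∫ t in (-(Real.pi / 2))..(Real.pi / 2),
        (Real.exp (-(2 / Real.pi ^ 2 * V) * t ^ 2) + Real.exp (-(L / (8 * m ^ 2)))) := by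
    refine intervalIntegral.integral_mono_on (by linarith) (hii _ _)
      (Continuous.intervalIntegrable (by fun_prop) _ _) fun t ht => ?_
    exact prod_abs_cos_le hm ham hV hL (abs_le.2 ht)
  rw [intervalIntegral.integral_add (hgi.intervalIntegrable)
    (Continuous.intervalIntegrable (by fun_prop) _ _), intervalIntegral.integral_const] at hle
  have hg : ∫ t in (-(Real.pi / 2))..(Real.pi / 2), Real.exp (-(2 / Real.pi ^ 2 * V) * t ^ 2) ≤
      Real.pi * √(Real.pi / (2 * V)) := by
    rw [intervalIntegral.integral_of_le (by linarith)]
    refine (setIntegral_le_integral hgi (Eventually.of_forall fun _ => (Real.exp_pos _).le)).trans ?_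
    rw [integral_gaussian]
    refine le_of_eq ?_
    rw [show Real.pi / (2 / Real.pi ^ 2 * V) = Real.pi ^ 2 * (Real.pi / (2 * V)) by field_simp,
      Real.sqrt_mul (by positivity), Real.sqrt_sq hpi.le]
  rw [hhalf, smul_eq_mul, show Real.pi / 2 - -(Real.pi / 2) = Real.pi by ring] at *
  rw [inv_mul_le_iff₀ (by positivity)]
  nlinarith

/-! ### Growth of `exp (x ^ β)` -/

section StretchedExponential

variable {β : ℝ}

/-- Bernoulli's inequality based at `x + 1`, with the factor `(x + 1) ^ β ≥ 1` discarded. This crude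
bound suffices: it only enters an exponentially small error term. -/
lemma div_add_one_le_rpow_add_one_sub_rpow (hβ0 : 0 ≤ β) (hβ1 : β ≤ 1) {x : ℝ} (hx : 0 ≤ x) :
    β / (x + 1) ≤ (x + 1) ^ β - x ^ β := by
  have hx1 : 0 < x + 1 := by linarith
  have h1 : x ^ β = (x + 1) ^ β * (1 + -(1 / (x + 1))) ^ β := by
    have h0 : 1 + -(1 / (x + 1)) = x / (x + 1) := by field_simp; ring
    rw [h0, Real.div_rpow hx hx1.le, mul_div_cancel₀]
    positivity
  have h2 : (1 + -(1 / (x + 1))) ^ β ≤ 1 + β * -(1 / (x + 1)) := by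
    refine rpow_one_add_le_one_add_mul_self ?_ hβ0 hβ1
    rw [neg_le_neg_iff, div_le_one hx1]
    linarith
  have h3 : 1 ≤ (x + 1) ^ β := Real.one_le_rpow (by linarith) hβ0
  have h4 : x ^ β ≤ (x + 1) ^ β * (1 + β * -(1 / (x + 1))) := by
    rw [h1]; gcongr
  have h5 : 0 ≤ β / (x + 1) := by positivity
  have h6 : β * -(1 / (x + 1)) = -(β / (x + 1)) := by ring
  rw [h6] at h4
  nlinarith

/-- Bernoulli's inequality based at `x`. The exponent `β - 1` matters: it is the source of the gain
over `1 / m` that makes the final series converge. -/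
lemma rpow_add_one_sub_rpow_le (hβ0 : 0 ≤ β) (hβ1 : β ≤ 1) {x : ℝ} (hx : 0 < x) :
    (x + 1) ^ β - x ^ β ≤ x ^ (β - 1) := by
  have h1 : (x + 1) ^ β = x ^ β * (1 + 1 / x) ^ β := by
    rw [← Real.mul_rpow hx.le (by positivity)]
    congr 1; field_simp
  have h2 : (1 + 1 / x) ^ β ≤ 1 + β * (1 / x) :=
    rpow_one_add_le_one_add_mul_self (by have : 0 ≤ 1 / x := by positivity
                                         linarith) hβ0 hβ1
  have h3 : x ^ (β - 1) = x ^ β * (1 / x) := by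
    rw [Real.rpow_sub_one hx.ne']; ring
  have h4 : x ^ β * (1 + 1 / x) ^ β ≤ x ^ β * (1 + β * (1 / x)) := by gcongr
  have h5 : x ^ β * (β * (1 / x)) ≤ x ^ β * (1 * (1 / x)) := by gcongr
  rw [h1, h3]
  linarith

lemma eventually_mul_pow_le_exp_rpow (hβ0 : 0 < β) (K : ℝ) (p : ℕ) :
    ∀ᶠ x : ℝ in atTop, K * x ^ p ≤ Real.exp (x ^ β) := by
  have h := (tendsto_exp_div_rpow_atTop (p / β)).comp (tendsto_rpow_atTop hβ0)
  filter_upwards [h.eventually_ge_atTop K, eventually_gt_atTop 0] with x hx hx0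
  simp only [Function.comp_apply] at hx
  rw [← Real.rpow_mul hx0.le, mul_div_cancel₀ _ hβ0.ne', Real.rpow_natCast,
    le_div_iff₀ (by positivity)] at hx
  exact hx

lemma eventually_exp_rpow_half_le (hβ0 : 0 < β) :
    ∀ᶠ x : ℝ in atTop, Real.exp ((x / 2) ^ β) ≤ Real.exp (x ^ β) / 2 := by
  have hc : 0 < 1 - (1 / 2 : ℝ) ^ β := by
    have := Real.rpow_lt_one (x := (1 / 2 : ℝ)) (by norm_num) (by norm_num) hβ0
    linarith
  have h := (tendsto_rpow_atTop hβ0).const_mul_atTop hc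
  filter_upwards [h.eventually_ge_atTop (Real.log 2), eventually_gt_atTop 0] with x hx hx0
  rw [le_div_iff₀ two_pos]
  nth_rewrite 2 [← Real.exp_log two_pos]
  rw [← Real.exp_add, Real.exp_le_exp, div_eq_mul_one_div, Real.mul_rpow hx0.le (by norm_num)]
  linarith

lemma exp_rpow_mul_div_le_sub (hβ0 : 0 ≤ β) (hβ1 : β ≤ 1) {x : ℝ} (hx : 0 ≤ x) :
    Real.exp (x ^ β) * (β / (x + 1)) ≤ Real.exp ((x + 1) ^ β) - Real.exp (x ^ β) := by
  have h1 := div_add_one_le_rpow_add_one_sub_rpow hβ0 hβ1 hx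
  have h2 := Real.add_one_le_exp ((x + 1) ^ β - x ^ β)
  have h3 : Real.exp ((x + 1) ^ β) = Real.exp (x ^ β) * Real.exp ((x + 1) ^ β - x ^ β) := by
    rw [← Real.exp_add]; ring_nf
  rw [h3]
  have h4 := Real.exp_pos (x ^ β)
  nlinarith

lemma exp_rpow_sub_le (hβ0 : 0 ≤ β) (hβ1 : β ≤ 1) {x : ℝ} (hx : 0 < x) :
    Real.exp ((x + 1) ^ β) - Real.exp (x ^ β) ≤ Real.exp ((x + 1) ^ β) * x ^ (β - 1) := by
  have h1 := rpow_add_one_sub_rpow_le hβ0 hβ1 hx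
  have h2 := Real.add_one_le_exp (-((x + 1) ^ β - x ^ β))
  have h3 : Real.exp (x ^ β) = Real.exp ((x + 1) ^ β) * Real.exp (-((x + 1) ^ β - x ^ β)) := by
    rw [← Real.exp_add]; ring_nf
  rw [h3]
  have h4 := Real.exp_pos ((x + 1) ^ β)
  nlinarith

lemma exp_rpow_mono (hβ0 : 0 ≤ β) {x y : ℝ} (hx : 0 ≤ x) (h : x ≤ y) :
    Real.exp (x ^ β) ≤ Real.exp (y ^ β) :=
  Real.exp_le_exp.2 (Real.rpow_le_rpow hx h hβ0)

end StretchedExponential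

/-! ### Blocks of constant step size -/

section Blocks

/-- The first index `n` with `j ≤ (log n) ^ α`, where `β = 1 / α`. -/
noncomputable def blockStart (β : ℝ) (j : ℕ) : ℕ := ⌈Real.exp ((j : ℝ) ^ β)⌉₊

lemma le_blockStart (β : ℝ) (j : ℕ) : Real.exp ((j : ℝ) ^ β) ≤ blockStart β j := Nat.le_ceil _

lemma blockStart_lt (β : ℝ) (j : ℕ) : (blockStart β j : ℝ) < Real.exp ((j : ℝ) ^ β) + 1 :=
  Nat.ceil_lt_add_one (Real.exp_pos _).le

lemma one_le_blockStart (β : ℝ) (j : ℕ) : 1 ≤ blockStart β j :=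
  Nat.one_le_iff_ne_zero.2 (Nat.ceil_pos.2 (Real.exp_pos _)).ne'

lemma blockStart_mono {β : ℝ} (hβ : 0 ≤ β) {i j : ℕ} (h : i ≤ j) :
    blockStart β i ≤ blockStart β j :=
  Nat.ceil_mono (exp_rpow_mono hβ (Nat.cast_nonneg _) (by exact_mod_cast h))

/-- The step sizes `⌊(log n) ^ α⌋`. -/
noncomputable def logStep (α : ℝ) (n : ℕ) : ℕ := ⌊Real.log n ^ α⌋₊

lemma le_logStep_iff {α : ℝ} (hα : 0 < α) {j : ℕ} (hj : 1 ≤ j) (n : ℕ) :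
    j ≤ logStep α n ↔ blockStart α⁻¹ j ≤ n := by
  have hlog : 0 ≤ Real.log n := Real.log_natCast_nonneg n
  rw [logStep, Nat.le_floor_iff (by positivity), blockStart, Nat.ceil_le]
  rcases Nat.eq_zero_or_pos n with rfl | hn
  -- At `n = 0` the convention `log 0 = 0` makes both sides false.
  · have h1 : (1 : ℝ) ≤ j := by exact_mod_cast hj
    have h2 := Real.exp_pos ((j : ℝ) ^ α⁻¹)
    simp only [Nat.cast_zero, Real.log_zero, Real.zero_rpow hα.ne']
    constructor <;> intro h <;> linarith
  · rw [← Real.le_log_iff_exp_le (by exact_mod_cast hn),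
      Real.rpow_inv_le_iff_of_pos (Nat.cast_nonneg _) hlog hα]

lemma logStep_eq_iff {α : ℝ} (hα : 0 < α) {j : ℕ} (hj : 1 ≤ j) (n : ℕ) :
    logStep α n = j ↔ blockStart α⁻¹ j ≤ n ∧ n < blockStart α⁻¹ (j + 1) := by
  rw [← le_logStep_iff hα hj, ← not_le, ← le_logStep_iff hα (by omega)]
  omega

lemma tendsto_logStep {α : ℝ} (hα : 0 < α) : Tendsto (logStep α) atTop atTop := by
  refine tendsto_atTop.2 fun j => ?_
  filter_upwards [eventually_ge_atTop (blockStart α⁻¹ (j + 1))] with n hn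
  have := (le_logStep_iff hα (by omega : 1 ≤ j + 1) n).2 hn
  omega

variable {α : ℝ}

lemma sub_sub_one_le_card_logStep_eq (hα : 0 < α) {i M : ℕ} (hi : 1 ≤ i)
    (hM : blockStart α⁻¹ (i + 1) ≤ M + 1) :
    Real.exp (((i + 1 : ℕ) : ℝ) ^ α⁻¹) - Real.exp ((i : ℝ) ^ α⁻¹) - 1 ≤
      ((Finset.range M).filter fun k => logStep α (k + 1) = i).card := by
  have h1 : Finset.Ico (blockStart α⁻¹ i - 1) (blockStart α⁻¹ (i + 1) - 1) ⊆
      (Finset.range M).filter fun k => logStep α (k + 1) = i := by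
    intro k hk
    rw [Finset.mem_Ico] at hk
    rw [Finset.mem_filter, Finset.mem_range, logStep_eq_iff hα hi]
    omega
  have h2 := Finset.card_le_card h1
  rw [Nat.card_Ico] at h2
  have h3 : blockStart α⁻¹ (i + 1) ≤
      ((Finset.range M).filter fun k => logStep α (k + 1) = i).card + blockStart α⁻¹ i := by
    have := one_le_blockStart α⁻¹ i
    omega
  have h4 : (blockStart α⁻¹ (i + 1) : ℝ) ≤
      ((Finset.range M).filter fun k => logStep α (k + 1) = i).card + blockStart α⁻¹ i := by
    exact_mod_cast h3
  linarith [le_blockStart α⁻¹ (i + 1), blockStart_lt α⁻¹ i]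

/-- Keep only the steps from block `j` on, each at least `j`; the `- 1` pays for rounding up in
`blockStart`. -/
lemma mul_sq_le_sum_logStep_sq (hα : 0 < α) {j i : ℕ} (hj : 1 ≤ j) (hji : j ≤ i) :
    (Real.exp ((i : ℝ) ^ α⁻¹) - Real.exp ((j : ℝ) ^ α⁻¹) - 1) * (j : ℝ) ^ 2 ≤
      ∑ k ∈ Finset.range (blockStart α⁻¹ i - 1), (logStep α (k + 1) : ℝ) ^ 2 := by
  have hjpos := one_le_blockStart α⁻¹ j
  have hmono := blockStart_mono (inv_nonneg.2 hα.le) hji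
  have h1 : Finset.Ico (blockStart α⁻¹ j - 1) (blockStart α⁻¹ i - 1) ⊆
      Finset.range (blockStart α⁻¹ i - 1) := by
    intro k hk
    rw [Finset.mem_Ico] at hk
    exact Finset.mem_range.2 hk.2
  refine le_trans ?_ (Finset.sum_le_sum_of_subset_of_nonneg h1 fun _ _ _ => sq_nonneg _)
  refine le_trans ?_ (Finset.card_nsmul_le_sum _ _ ((j : ℝ) ^ 2) fun k hk => ?_)
  · rw [nsmul_eq_mul, Nat.card_Ico, Nat.sub_sub_sub_cancel_right hjpos, Nat.cast_sub hmono]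
    refine mul_le_mul_of_nonneg_right ?_ (sq_nonneg _)
    linarith [le_blockStart α⁻¹ i, blockStart_lt α⁻¹ j]
  · rw [Finset.mem_Ico] at hk
    have := (le_logStep_iff hα hj (k + 1)).2 (by omega)
    gcongr

end Blocks

/-! ### Asymptotics, the local bound and Borel–Cantelli -/

/-- The Gaussian term gives `6`, since `8 * π < 36`. The other term gives `1`: its exponent beats
`log x + (x + 1) ^ β / 2`, because `exp ((x - 1) ^ β)` outgrows every power of `x`. -/
lemma eventually_sqrt_add_exp_le {β : ℝ} (hβ0 : 0 < β) (hβ1 : β ≤ 1) :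
    ∀ᶠ x : ℝ in atTop,
      √(Real.pi / (2 * (x ^ 2 * Real.exp ((x + 1) ^ β) / 16))) +
        Real.exp (-((Real.exp ((x - 1) ^ β) * (β / (x + 1)) - 1) / (8 * x ^ 2))) ≤
      7 / (x * √(Real.exp ((x + 1) ^ β))) := by
  have hK : ∀ᶠ x : ℝ in atTop, 800 / β * (x - 1) ^ 4 ≤ Real.exp ((x - 1) ^ β) :=
    (tendsto_atTop_add_const_right atTop (-1 : ℝ) tendsto_id).eventually
      (eventually_mul_pow_le_exp_rpow hβ0 (800 / β) 4)
  filter_upwards [hK, eventually_ge_atTop 2] with x hx hx2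
  have hx0 : 0 < x := by linarith
  set u := Real.exp ((x + 1) ^ β) with hu
  have hu0 : 0 < u := Real.exp_pos _
  have hsu : 0 < √u := Real.sqrt_pos.2 hu0
  have h1 : √(Real.pi / (2 * (x ^ 2 * u / 16))) ≤ 6 / (x * √u) := by
    refine Real.sqrt_le_iff.2 ⟨by positivity, ?_⟩
    rw [div_pow, mul_pow, Real.sq_sqrt hu0.le, div_le_div_iff₀ (by positivity) (by positivity)]
    have : 0 < x ^ 2 * u := by positivity
    nlinarith [Real.pi_lt_four]
  have h2 : Real.exp (-((Real.exp ((x - 1) ^ β) * (β / (x + 1)) - 1) / (8 * x ^ 2))) ≤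
      1 / (x * √u) := by
    have hl : 1 / (x * √u) = Real.exp (-(Real.log x + (x + 1) ^ β / 2)) := by
      rw [Real.exp_neg, Real.exp_add, Real.exp_log hx0, hu, Real.exp_half, one_div]
    rw [hl, Real.exp_le_exp, neg_le_neg_iff, le_div_iff₀ (by positivity)]
    have hlog : Real.log x ≤ x := (Real.log_le_sub_one_of_pos hx0).trans (by linarith)
    have hpow : (x + 1) ^ β ≤ x + 1 := by
      calc (x + 1) ^ β ≤ (x + 1) ^ (1 : ℝ) :=
            Real.rpow_le_rpow_of_exponent_le (by linarith) hβ1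
        _ = x + 1 := Real.rpow_one _
    have h3 : 25 * x ^ 3 ≤ Real.exp ((x - 1) ^ β) * (β / (x + 1)) := by
      have h4 : 800 / β * (x - 1) ^ 4 * (β / (x + 1)) ≤
          Real.exp ((x - 1) ^ β) * (β / (x + 1)) := by gcongr
      refine le_trans ?_ h4
      have h5 : 800 / β * (x - 1) ^ 4 * (β / (x + 1)) = 800 * (x - 1) ^ 4 / (x + 1) := by
        field_simp
      rw [h5, le_div_iff₀ (by linarith)]
      have h6 : (x / 2) ^ 4 ≤ (x - 1) ^ 4 := by gcongr; linarith
      have h7 : x + 1 ≤ 2 * x := by linarith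
      have h8 : 25 * x ^ 3 * (x + 1) ≤ 25 * x ^ 3 * (2 * x) := by gcongr
      have h9 : 800 * (x / 2) ^ 4 = 25 * x ^ 3 * (2 * x) := by ring
      linarith
    have h10 : (Real.log x + (x + 1) ^ β / 2) * (8 * x ^ 2) ≤ (x + (x + 1) / 2) * (8 * x ^ 2) := by
      gcongr
    nlinarith [mul_pos hx0 hx0, mul_nonneg (sq_nonneg x) (by linarith : 0 ≤ x - 2)]
  calc _ ≤ 6 / (x * √u) + 1 / (x * √u) := add_le_add h1 h2
    _ = _ := by ring

lemma eventually_sq_mul_le_sum_logStep_sq {α : ℝ} (hα : 0 < α) :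
    ∀ᶠ m : ℕ in atTop, (m : ℝ) ^ 2 * Real.exp (((m : ℝ) + 1) ^ α⁻¹) / 16 ≤
      ∑ k ∈ Finset.range (blockStart α⁻¹ (m + 1) - 1), (logStep α (k + 1) : ℝ) ^ 2 := by
  have hβ := inv_pos.2 hα
  have hcast : Tendsto (fun m : ℕ => (m : ℝ) + 1) atTop atTop :=
    tendsto_atTop_add_const_right atTop 1 tendsto_natCast_atTop_atTop
  filter_upwards [hcast.eventually (eventually_exp_rpow_half_le hβ),
    hcast.eventually (eventually_mul_pow_le_exp_rpow hβ 4 1), eventually_ge_atTop 1]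
    with m h1 h2 hm
  -- Steps smaller than about `m / 2` occupy at most about half of the time, so the rest give the
  -- variance.
  have hj : 1 ≤ (m + 1) / 2 := by omega
  have h := mul_sq_le_sum_logStep_sq hα hj (by omega : (m + 1) / 2 ≤ m + 1)
  refine le_trans ?_ h
  have hj1 : (m : ℝ) / 2 ≤ ((m + 1) / 2 : ℕ) := by
    have : m ≤ 2 * ((m + 1) / 2) := by omega
    have : (m : ℝ) ≤ 2 * ((m + 1) / 2 : ℕ) := by exact_mod_cast this
    linarith
  have hj2 : (((m + 1) / 2 : ℕ) : ℝ) ≤ ((m : ℝ) + 1) / 2 := by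
    have := Nat.cast_div_le (α := ℝ) (m := m + 1) (n := 2)
    exact_mod_cast this
  have h3 := exp_rpow_mono hβ.le (Nat.cast_nonneg _) hj2
  have hm0 : (0 : ℝ) ≤ m := Nat.cast_nonneg _
  push_cast
  set u := Real.exp (((m : ℝ) + 1) ^ α⁻¹)
  have hsq : ((m : ℝ) / 2) ^ 2 ≤ (((m + 1) / 2 : ℕ) : ℝ) ^ 2 := by gcongr
  have hu0 : 0 < u := Real.exp_pos _
  calc (m : ℝ) ^ 2 * u / 16 = u / 4 * ((m : ℝ) / 2) ^ 2 := by ring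
    _ ≤ _ := mul_le_mul (by linarith) hsq (by positivity) (by linarith)

namespace IsRademacherFamily

variable {Ω : Type*} [MeasurableSpace Ω] {μ : Measure Ω} [IsProbabilityMeasure μ]

lemma eventually_prob_walk_eq_le {ε : ℕ → Ω → ℝ} (hε : IsRademacherFamily μ ε) {α : ℝ}
    (hα : 1 < α) :
    ∀ᶠ m : ℕ in atTop, ∀ y : ℤ,
      μ.real {ω | rademacherWalk ε (fun k => (logStep α k : ℝ))
        (blockStart α⁻¹ (m + 1) - 1) ω = y} ≤
      7 / (m * √(Real.exp (((m : ℝ) + 1) ^ α⁻¹))) := by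
  have hα0 : 0 < α := by linarith
  have hβ0 := inv_pos.2 hα0
  have hβ1 : α⁻¹ ≤ 1 := inv_le_one_of_one_le₀ hα.le
  filter_upwards [tendsto_natCast_atTop_atTop.eventually (eventually_sqrt_add_exp_le hβ0 hβ1),
    eventually_sq_mul_le_sum_logStep_sq hα0, eventually_ge_atTop 2] with m h1 h2 hm y
  have hm0 : (0 : ℝ) < m := by exact_mod_cast (by omega : 0 < m)
  refine (hε.measureReal_walk_eq_le (logStep α) _ y).trans (le_trans ?_ h1)
  refine integral_prod_abs_cos_le (by omega) (by positivity) ?_ h2 ?_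
  · intro k hk
    by_contra hlt
    have := (le_logStep_iff hα0 (by omega) (k + 1)).1 (by omega : m + 1 ≤ logStep α (k + 1))
    omega
  -- Here `i` is `m - 1` or `m`, both at least `1`, and both blocks are complete at the end time.
  · intro i hi1 hi2
    have hstart := blockStart_mono hβ0.le (by omega : i + 1 ≤ m + 1)
    have hpos := one_le_blockStart α⁻¹ (m + 1)
    refine le_trans ?_ (sub_sub_one_le_card_logStep_eq hα0 (by omega : 1 ≤ i) (by omega))
    have h3 := exp_rpow_mul_div_le_sub hβ0.le hβ1 (Nat.cast_nonneg i)
    have h4 : (m : ℝ) - 1 ≤ i := by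
      have : (m : ℝ) ≤ i + 1 := by exact_mod_cast hi1
      linarith
    have hm2 : (2 : ℝ) ≤ m := by exact_mod_cast hm
    have h5 := exp_rpow_mono hβ0.le (by linarith : (0 : ℝ) ≤ m - 1) h4
    have h6 : α⁻¹ / ((m : ℝ) + 1) ≤ α⁻¹ / ((i : ℝ) + 1) := by
      have : (i : ℝ) ≤ m := by exact_mod_cast hi2
      gcongr
    have h7 : Real.exp (((m : ℝ) - 1) ^ α⁻¹) * (α⁻¹ / ((m : ℝ) + 1)) ≤
        Real.exp ((i : ℝ) ^ α⁻¹) * (α⁻¹ / ((i : ℝ) + 1)) := by gcongr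
    push_cast
    linarith

lemma eventually_prob_exists_abs_walk_le {ε : ℕ → Ω → ℝ} (hε : IsRademacherFamily μ ε) {α : ℝ}
    (hα : 1 < α) (C : ℕ) :
    ∀ᶠ m : ℕ in atTop,
      μ.real {ω | ∃ n, logStep α n = m ∧
        |rademacherWalk ε (fun k => (logStep α k : ℝ)) n ω| ≤ C} ≤
      4 / 3 * (2 * C + 1) * 49 * (m : ℝ) ^ ((α⁻¹ - 1) / 2 - 1) := by
  have hα0 : 0 < α := by linarith
  have hβ0 := inv_pos.2 hα0
  have hβ1 : α⁻¹ ≤ 1 := inv_le_one_of_one_le₀ hα.le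
  filter_upwards [hε.eventually_prob_walk_eq_le hα, eventually_ge_atTop 1,
    tendsto_natCast_atTop_atTop.eventually (eventually_mul_pow_le_exp_rpow hβ0 1 1)]
    with m hp hm hexp
  have hm0 : (0 : ℝ) < m := by exact_mod_cast hm
  set u := Real.exp (((m : ℝ) + 1) ^ α⁻¹) with hu
  have hu0 : 0 < u := Real.exp_pos _
  set N := blockStart α⁻¹ m with hN
  set M := blockStart α⁻¹ (m + 1) - 1 with hM
  have hpos := one_le_blockStart α⁻¹ (m + 1)
  -- `w ^ 2` bounds the block length. Since `w ≥ 1`, the choice `R = ⌈2 * w⌉₊` gives `2 * R + 1 ≤ 7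
  -- * w`, and with the `7` of the local bound the constant `49`.
  set w := √((m : ℝ) ^ (α⁻¹ - 1) * u) with hw
  have hw1 : 1 ≤ w := by
    rw [hw, Real.one_le_sqrt]
    have h1 : (m : ℝ) ≤ u := by
      have h2 := exp_rpow_mono hβ0.le hm0.le (by linarith : (m : ℝ) ≤ m + 1)
      linarith
    calc (1 : ℝ) ≤ (m : ℝ) ^ α⁻¹ :=
          Real.one_le_rpow (by exact_mod_cast hm) hβ0.le
      _ = (m : ℝ) ^ (α⁻¹ - 1) * m := by
          rw [Real.rpow_sub_one hm0.ne']; field_simp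
      _ ≤ _ := by gcongr
  have hD : ((M - N : ℕ) : ℝ) ≤ w ^ 2 := by
    rw [hw, Real.sq_sqrt (by positivity)]
    rcases le_total M N with h | h
    · rw [Nat.sub_eq_zero_of_le h, Nat.cast_zero]
      positivity
    · rw [Nat.cast_sub h, hM, Nat.cast_sub hpos]
      have h1 := exp_rpow_sub_le hβ0.le hβ1 hm0
      have h2 := blockStart_lt α⁻¹ (m + 1)
      have h3 := le_blockStart α⁻¹ m
      push_cast at h2 ⊢
      rw [mul_comm]
      linarith
  set R := ⌈2 * w⌉₊ with hR
  have hR1 : 2 * w ≤ R := Nat.le_ceil _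
  have hR2 : (R : ℝ) < 2 * w + 1 := Nat.ceil_lt_add_one (by linarith)
  have hRD : 4 * (M - N) ≤ R ^ 2 := by
    have : (4 : ℝ) * (M - N : ℕ) ≤ (R : ℝ) ^ 2 := by nlinarith
    exact_mod_cast this
  have h := hε.prob_exists_abs_walk_le (logStep α) (N := N) (M := M) (m := m) (C := C) (R := R)
    hRD (fun k hk1 hk2 => (logStep_eq_iff hα0 hm _).2 (by omega)) hp
  have hsub : {ω | ∃ n, logStep α n = m ∧
        |rademacherWalk ε (fun k => (logStep α k : ℝ)) n ω| ≤ C} ⊆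
      {ω | ∃ n, N ≤ n ∧ n ≤ M ∧ |rademacherWalk ε (fun k => (logStep α k : ℝ)) n ω| ≤ C} := by
    rintro ω ⟨n, hn, hX⟩
    have := (logStep_eq_iff hα0 hm n).1 hn
    exact ⟨n, this.1, by omega, hX⟩
  refine (measureReal_mono hsub (measure_ne_top _ _)).trans (h.trans ?_)
  have hsu : 0 < √u := Real.sqrt_pos.2 hu0
  have hwm : w / (m * √u) = (m : ℝ) ^ ((α⁻¹ - 1) / 2 - 1) := by
    rw [hw, Real.sqrt_mul (by positivity), Real.rpow_sub_one hm0.ne' ((α⁻¹ - 1) / 2),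
      Real.sqrt_eq_rpow ((m : ℝ) ^ (α⁻¹ - 1)), ← Real.rpow_mul hm0.le, mul_one_div]
    field_simp
  calc 4 / 3 * ((2 * C + 1) * (2 * R + 1) * (7 / (m * √u)))
      ≤ 4 / 3 * ((2 * C + 1) * (7 * w) * (7 / (m * √u))) := by
        gcongr
        linarith
    _ = 4 / 3 * (2 * C + 1) * 49 * (w / (m * √u)) := by ring
    _ = _ := by rw [hwm]

lemma measure_frequently_abs_walk_le_eq_zero {ε : ℕ → Ω → ℝ} (hε : IsRademacherFamily μ ε)
    {α : ℝ} (hα : 1 < α) (C : ℕ) :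
    μ {ω | ∃ᶠ n in atTop, |rademacherWalk ε (fun k => (logStep α k : ℝ)) n ω| ≤ C} = 0 := by
  have hα0 : 0 < α := by linarith
  set A : ℕ → Set Ω := fun m => {ω | ∃ n, logStep α n = m ∧
    |rademacherWalk ε (fun k => (logStep α k : ℝ)) n ω| ≤ C}
  have hsum : Summable fun m => μ.real (A m) := by
    -- The only place where `α > 1` is needed strictly: at `α = 1` the bound is harmonic.
    have hexp : (α⁻¹ - 1) / 2 - 1 < -1 := by
      have : α⁻¹ < 1 := inv_lt_one_of_one_lt₀ hα
      linarith
    refine Summable.of_norm_bounded_eventually_nat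
      (g := fun m : ℕ => 4 / 3 * (2 * (C : ℝ) + 1) * 49 * (m : ℝ) ^ ((α⁻¹ - 1) / 2 - 1))
      ((Real.summable_nat_rpow.2 hexp).mul_left _) ?_
    filter_upwards [hε.eventually_prob_exists_abs_walk_le hα C] with m hm
    rwa [Real.norm_of_nonneg measureReal_nonneg]
  have hlim : μ {ω | ∃ᶠ m in atTop, ω ∈ A m} = 0 := by
    refine measure_setOfPred_frequently_eq_zero ?_
    have := hsum.tsum_ofReal_ne_top
    simp only [ofReal_measureReal (measure_ne_top μ _)] at this
    exact this
  refine measure_mono_null (fun ω hω => ?_) hlim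
  -- As the step size tends to infinity, infinitely many visits mean visits in infinitely many
  -- blocks.
  refine (tendsto_logStep hα0).frequently ?_
  exact Frequently.mono hω fun n hn => ⟨n, rfl, hn⟩

end IsRademacherFamily

theorem corollary1p6 {Ω : Type*} [MeasurableSpace Ω] (μ : Measure Ω) [IsProbabilityMeasure μ]
    (ε : ℕ → Ω → ℝ) (hε : IsRademacherFamily μ ε) (α : ℝ) (hα : 1 < α) :
    IsTransient μ (rademacherWalk ε (fun n : ℕ => (⌊Real.log (n : ℝ) ^ α⌋ : ℝ))) := by
  have hstep : (fun n : ℕ => (⌊Real.log (n : ℝ) ^ α⌋ : ℝ)) = fun n => (logStep α n : ℝ) := by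
    funext n
    exact (natCast_floor_eq_intCast_floor
      (Real.rpow_nonneg (Real.log_natCast_nonneg n) α)).symm
  rw [hstep]
  intro h
  -- Integer `C` suffice, so the event is covered by countably many null sets; its probability is in
  -- fact `0`.
  have h0 : μ {ω | ∃ C : ℝ, ∃ᶠ n in atTop,
      |rademacherWalk ε (fun n => (logStep α n : ℝ)) n ω| ≤ C} = 0 := by
    refine measure_mono_null (fun ω hω => ?_)
      (measure_iUnion_null fun C : ℕ => hε.measure_frequently_abs_walk_le_eq_zero hα C)
    obtain ⟨C, hC⟩ := hω
    exact Set.mem_iUnion.2 ⟨⌈C⌉₊, hC.mono fun n hn => hn.trans (Nat.le_ceil C)⟩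
  rw [IsWeaklyRecurrent, h0] at h
  exact zero_ne_one h
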